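/- Let $X$ and $Y$ be complex Banach spaces and let $\Lambda\subset\mathbb C$ be open and connected. A function $A:\Lambda\to\mathcal L(X,Y)$ is called a holomorphic Fredholm operator-valued function if it is complex differentiable in the operator norm at every point of $\Lambda$, $A(k)$ is a Fredholm operator for every $k\in\Lambda$, and $A(k)$ is invertible for at least one $k\in\Lambda$. A point $k$ in the domain of an operator-valued function $A$ is an eigenvalue of $A$ if $A(k)$ is not injective; its geometric multiplicity is $\dim N(A(k))$, where $N$ denotes the null space. A Jordan chain of length $n\ge 1$ of $A$ at $k$ is a tuple $(\varphi_0,\dots,\varphi_{n-1})$ in $X$ with $\varphi_0\neq 0$ and $$\sum_{l=0}^{j}\frac1{l!}A^{(l)}(k)\varphi_{j-l}=0\qquad (j=0,\dots,n-1).$$ A canonical system of Jordan chains of $A$ at $k$ is a finite family of Jordan chains $(\varphi_{i,0},\dots,\varphi_{i,n_i-1})$, $i=1,\dots,r$, such that $\varphi_{1,0},\dots,\varphi_{r,0}$ is a basis of $N(A(k))$ and, for each $i$, $n_i$ is the largest length of a Jordan chain of $A$ at $k$ whose first vector is not in the span of $\varphi_{1,0},\dots,\varphi_{i-1,0}$.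 The algebraic multiplicity of $k$ is the sum $n_1+\dots+n_r$ of the lengths of the chains in a canonical system. Theorem. Let $A:\Lambda\to\mathcal L(X,Y)$ be a holomorphic Fredholm operator-valued function, let $k_0\in\Lambda$ be an eigenvalue of $A$ with geometric multiplicity $m$, and let $B\in\mathcal L(X,Y)$ be a nonzero operator. Then there exist open neighborhoods $V\subset\mathbb C$ of $0$ and $\Lambda_0\subset\Lambda$ of $k_0$ and a function $F:V\times\Lambda_0\to\mathcal L(\mathbb C^m,\mathbb C^m)$ such that 1. for every $\varepsilon\in V$, $k\mapsto F(\varepsilon,k)$ is holomorphic on $\Lambda_0$; 2. for every $k\in\Lambda_0$, $\varepsilon\mapsto F(\varepsilon,k)$ is holomorphic on $V$; 3. for every $\varepsilon\in V$, a point $k\in\Lambda_0$ is an eigenvalue of $A+\varepsilon B$ if and only if it is an eigenvalue of $k\mapsto F(\varepsilon,k)$; 4. the geometric multiplicities of the eigenvalue $k_0$ of $A$ and of $k\mapsto F(0,k)$ coincide; 5. the algebraic multiplicities of the eigenvalue $k_0$ of $A$ and of $k\mapsto F(0,k)$ exist (as finite numbers) and coincide. -/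

import Mathlib

section FredholmFunctions

variable {X Y : Type*} [NormedAddCommGroup X] [NormedSpace ℂ X]
  [NormedAddCommGroup Y] [NormedSpace ℂ Y]

/-- `A` is a holomorphic Fredholm operator-valued function on `Λ`. Only the values of `A` on `Λ`
matter. -/
structure IsHolomorphicFredholmOn (A : ℂ → X →L[ℂ] Y) (Λ : Set ℂ) : Prop where
  holomorphic : DifferentiableOn ℂ A Λ
  fredholm : ∀ k ∈ Λ, (A k).IsFredholm
  exists_invertible : ∃ k ∈ Λ, (A k).IsInvertible

/-- A point `k` of the domain of an operator-valued function `A` is an eigenvalue of `A` if `A k`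
is not injective. -/
def IsEigenvalueOf (A : ℂ → X →L[ℂ] Y) (k : ℂ) : Prop :=
  ¬ Function.Injective (A k)

/-- The geometric multiplicity of `k`: the dimension of the eigenspace `N(A(k))`. -/
noncomputable def geometricMultiplicity (A : ℂ → X →L[ℂ] Y) (k : ℂ) : ℕ :=
  Module.finrank ℂ (LinearMap.ker (A k : X →ₗ[ℂ] Y))

/-- `(u 0, …, u (n - 1))` is a Jordan chain of length `n` of `A` at `k` (the values `u j` with
`n ≤ j` are irrelevant). -/
structure IsJordanChain (A : ℂ → X →L[ℂ] Y) (k : ℂ) (n : ℕ) (u : ℕ → X) : Prop where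
  length_pos : 1 ≤ n
  leading_ne_zero : u 0 ≠ 0
  chain : ∀ j < n,
    ∑ l ∈ Finset.range (j + 1), ((l.factorial : ℂ)⁻¹) • (iteratedDeriv l A k) (u (j - l)) = 0

/-- A canonical system of Jordan chains of `A` at `k`: the chain `u i` has length `n i`, the leading
eigenvectors `u i 0` form a basis of `N(A(k))`, and each `n i` is the largest length of any Jordan
chain whose leading eigenvector is not in the span of the preceding `u j 0`, `j < i`. -/
structure IsCanonicalSystem (A : ℂ → X →L[ℂ] Y) (k : ℂ) {r : ℕ}
    (u : Fin r → ℕ → X) (n : Fin r → ℕ) : Prop where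
  isJordanChain : ∀ i, IsJordanChain A k (n i) (u i)
  linearIndependent : LinearIndependent ℂ (fun i => u i 0)
  span_eq : Submodule.span ℂ (Set.range fun i => u i 0) = LinearMap.ker (A k : X →ₗ[ℂ] Y)
  maximal : ∀ (i : Fin r) (N : ℕ) (ψ : ℕ → X), IsJordanChain A k N ψ →
    ψ 0 ∉ Submodule.span ℂ ((fun j => u j 0) '' {j | j < i}) → N ≤ n i

/-- `p` is the algebraic multiplicity of `A` at `k`: the sum of the lengths of the chains in a
canonical system of Jordan chains (the sum of the partial multiplicities). -/
def HasAlgebraicMultiplicity (A : ℂ → X →L[ℂ] Y) (k : ℂ) (p : ℕ) : Prop :=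
  ∃ (r : ℕ) (u : Fin r → ℕ → X) (n : Fin r → ℕ), IsCanonicalSystem A k u n ∧ ∑ i, n i = p

end FredholmFunctions

/-!
The operator function is reduced to a matrix function by bordering. Let `m` be the geometric
multiplicity of `k₀`. With coordinates `P : X → ℂᵐ` on the null space of `A k₀` and a parametrization
`R : ℂⁿ → Y` of a complement of its range, the operator `(x, w) ↦ (T x + R w, P x)` is invertible for
`T = A k₀`, hence for all `T = A k + ε B` with `(ε, k)` near `(0, k₀)`. If its inverse has the blocks
`S`, `S₊`, `S₋`, `-F` (`F` is `effective R P T`, `S₊` is `borderedInvUpper`, `S₋` is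
`borderedInvLower`), then

  `F P = S₋ T`,  `T S₊ = R F`,  `P S₊ = 1`,  and `S₊ P = 1` on the null space of `T`.

Hence `T` and `F` have isomorphic null spaces (`kerEquivKerEffective`), and `T` is bijective if and
only if `F` is (`bijective_effective_iff`). The function `F` inherits holomorphy in `ε` and in `k`
from the bordered operator.

The first two identities say that `A` and `k ↦ F(0, k)` are intertwined in both directions. On Taylor
coefficients at `k₀`, an intertwining relation carries Jordan chains to Jordan chains by a Cauchy
product (`IsJordanChain.map`), and since the maps are mutually inverse on the null spaces, canonical
systems are carried to canonical systems of the same lengths (`HasAlgebraicMultiplicity.map`).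

That `n = m`, so that `F` is square, and that the algebraic multiplicity is finite both rest on `A`
being invertible in a punctured neighborhood of `k₀`
(`IsHolomorphicFredholmOn.eventually_bijective`). Locally, invertibility of `A k` amounts to
`n = m` and the nonvanishing of the holomorphic function `det F`, so near each point it holds on a
punctured neighborhood or nowhere on one; connectedness excludes the second case. Then `det F`
vanishes at `k₀` to a finite order `N`, the identity `adj F · F = det F` bounds the length of Jordan
chains by `N` (`exists_bound_isJordanChain`), and a canonical system is obtained by choosing chains
of maximal length greedily (`exists_greedy_jordanChains`).
-/

open Filter Topology Finset

/-! ### Taylor coefficients -/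

section TaylorCoefficients

variable {E F G : Type*} [NormedAddCommGroup E] [NormedSpace ℂ E]
  [NormedAddCommGroup F] [NormedSpace ℂ F] [NormedAddCommGroup G] [NormedSpace ℂ G]

/-- The `l`-th Taylor coefficient `f⁽ˡ⁾(k) / l!` of `f` at `k`. -/
noncomputable def taylorCoeff (f : ℂ → E) (k : ℂ) (l : ℕ) : E :=
  ((l.factorial : ℂ)⁻¹) • iteratedDeriv l f k

@[simp]
lemma taylorCoeff_zero (f : ℂ → E) (k : ℂ) : taylorCoeff f k 0 = f k := by
  simp [taylorCoeff]

lemma taylorCoeff_congr {f g : ℂ → E} {k : ℂ} (h : f =ᶠ[𝓝 k] g) :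
    taylorCoeff f k = taylorCoeff g k := by
  ext1 l
  simp [taylorCoeff, h.iteratedDeriv_eq l]

lemma taylorCoeff_deriv (f : ℂ → E) (k : ℂ) (l : ℕ) :
    taylorCoeff (deriv f) k l = ((l : ℂ) + 1) • taylorCoeff f k (l + 1) := by
  have h : (l : ℂ) + 1 ≠ 0 := Nat.cast_add_one_ne_zero l
  rw [taylorCoeff, taylorCoeff, smul_smul, iteratedDeriv_succ', Nat.factorial_succ]
  push_cast
  rw [mul_inv, mul_inv_cancel_left₀ h]

variable [CompleteSpace E] [CompleteSpace F] [CompleteSpace G]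

lemma taylorCoeff_add {f g : ℂ → E} {k : ℂ} (hf : AnalyticAt ℂ f k) (hg : AnalyticAt ℂ g k)
    (l : ℕ) :
    taylorCoeff (fun z => f z + g z) k l = taylorCoeff f k l + taylorCoeff g k l := by
  rw [taylorCoeff, taylorCoeff, taylorCoeff, ← smul_add]
  congr 1
  exact iteratedDeriv_add hf.contDiffAt hg.contDiffAt

/-- The Cauchy product formula for Taylor coefficients with respect to a continuous bilinear map.
It follows by induction from the recursion `(l + 1) f_{l+1} = (f')_l`. -/
lemma taylorCoeff_bilinear (b : E →L[ℂ] F →L[ℂ] G) (k : ℂ) (n : ℕ) :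
    ∀ {f : ℂ → E} {g : ℂ → F}, AnalyticAt ℂ f k → AnalyticAt ℂ g k →
      taylorCoeff (fun z => b (f z) (g z)) k n =
        ∑ p ∈ antidiagonal n, b (taylorCoeff f k p.1) (taylorCoeff g k p.2) := by
  induction n with
  | zero => intros; simp
  | succ n ih =>
    intro f g hf hg
    have h0 : (n : ℂ) + 1 ≠ 0 := Nat.cast_add_one_ne_zero n
    have hd : deriv (fun z => b (f z) (g z)) =ᶠ[𝓝 k]
        fun z => b (deriv f z) (g z) + b (f z) (deriv g z) := by
      filter_upwards [hf.eventually_analyticAt, hg.eventually_analyticAt] with z hfz hgz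
      have := ((b.hasFDerivAt.comp_hasDerivAt z hfz.differentiableAt.hasDerivAt).clm_apply
        hgz.differentiableAt.hasDerivAt).deriv
      simpa using this
    have hb (u : ℂ → E) (v : ℂ → F) (hu : AnalyticAt ℂ u k) (hv : AnalyticAt ℂ v k) :
        AnalyticAt ℂ (fun z => b (u z) (v z)) k :=
      (b.analyticAt_bilinear (u k, v k)).comp₂ hu hv
    rw [← smul_right_injective G h0 |>.eq_iff, ← taylorCoeff_deriv, taylorCoeff_congr hd,
      taylorCoeff_add (hb _ _ hf.deriv hg) (hb _ _ hf hg.deriv), ih hf.deriv hg, ih hf hg.deriv]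
    simp only [taylorCoeff_deriv, map_smul, _root_.smul_apply]
    -- On the antidiagonal of `n + 1`, the factor `n + 1` is `p.1 + p.2`.
    have key : ((n : ℂ) + 1) • ∑ p ∈ antidiagonal (n + 1),
          b (taylorCoeff f k p.1) (taylorCoeff g k p.2) =
        ∑ p ∈ antidiagonal (n + 1), (p.1 : ℂ) • b (taylorCoeff f k p.1) (taylorCoeff g k p.2) +
        ∑ p ∈ antidiagonal (n + 1),
          (p.2 : ℂ) • b (taylorCoeff f k p.1) (taylorCoeff g k p.2) := by
      rw [smul_sum, ← sum_add_distrib]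
      refine sum_congr rfl fun p hp => ?_
      rw [← add_smul, ← Nat.cast_add, HasAntidiagonal.mem_antidiagonal.1 hp]
      push_cast; rfl
    rw [key, Nat.sum_antidiagonal_succ, Nat.sum_antidiagonal_succ']
    simp

end TaylorCoefficients

/-! ### Jordan chains and intertwined operator functions -/

section JordanChains

variable {X Y X' Y' : Type*} [NormedAddCommGroup X] [NormedSpace ℂ X]
  [NormedAddCommGroup Y] [NormedSpace ℂ Y] [NormedAddCommGroup X'] [NormedSpace ℂ X']
  [NormedAddCommGroup Y'] [NormedSpace ℂ Y']

/-- The `j`-th coefficient of the formal power series `A(k + t) u(t)`, where `u(t) = ∑ uₗ tˡ`. -/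
noncomputable def coeffApply (A : ℂ → X →L[ℂ] Y) (k : ℂ) (u : ℕ → X) (j : ℕ) : Y :=
  ∑ p ∈ antidiagonal j, taylorCoeff A k p.1 (u p.2)

@[simp]
lemma coeffApply_zero (A : ℂ → X →L[ℂ] Y) (k : ℂ) (u : ℕ → X) :
    coeffApply A k u 0 = A k (u 0) := by
  simp [coeffApply]

lemma coeffApply_congr {A B : ℂ → X →L[ℂ] Y} {k : ℂ} (h : A =ᶠ[𝓝 k] B) (u : ℕ → X) :
    coeffApply A k u = coeffApply B k u := by
  ext1 j
  simp [coeffApply, taylorCoeff_congr h]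

lemma coeffApply_eq_zero_of_forall_le {A : ℂ → X →L[ℂ] Y} {k : ℂ} {u : ℕ → X} {j : ℕ}
    (h : ∀ i ≤ j, u i = 0) : coeffApply A k u j = 0 :=
  sum_eq_zero fun p hp => by
    rw [h p.2 (by rw [← HasAntidiagonal.mem_antidiagonal.1 hp]; omega), map_zero]

lemma isJordanChain_iff {A : ℂ → X →L[ℂ] Y} {k : ℂ} {n : ℕ} {u : ℕ → X} :
    IsJordanChain A k n u ↔ 1 ≤ n ∧ u 0 ≠ 0 ∧ ∀ j < n, coeffApply A k u j = 0 := by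
  have h (j : ℕ) : coeffApply A k u j = ∑ l ∈ range (j + 1),
      ((l.factorial : ℂ)⁻¹) • (iteratedDeriv l A k) (u (j - l)) := by
    rw [coeffApply, Nat.sum_antidiagonal_eq_sum_range_succ fun i l => taylorCoeff A k i (u l)]
    simp [taylorCoeff]
  simp only [h]
  exact ⟨fun h => ⟨h.1, h.2, h.3⟩, fun h => ⟨h.1, h.2.1, h.2.2⟩⟩

lemma IsJordanChain.apply_leading {A : ℂ → X →L[ℂ] Y} {k : ℂ} {n : ℕ} {u : ℕ → X}
    (h : IsJordanChain A k n u) : A k (u 0) = 0 := by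
  simpa using (isJordanChain_iff.1 h).2.2 0 h.1

variable [CompleteSpace X] [CompleteSpace Y] [CompleteSpace X'] [CompleteSpace Y']

omit [CompleteSpace X] in
/-- Composing operator functions composes their actions on formal power series. -/
lemma coeffApply_comp {A : ℂ → Y →L[ℂ] Y'} {B : ℂ → X →L[ℂ] Y} {k : ℂ}
    (hA : AnalyticAt ℂ A k) (hB : AnalyticAt ℂ B k) (u : ℕ → X) (j : ℕ) :
    coeffApply (fun z => (A z).comp (B z)) k u j = coeffApply A k (coeffApply B k u) j := by
  have h (n : ℕ) := taylorCoeff_bilinear (ContinuousLinearMap.compL ℂ X Y Y') k n hA hB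
  simp only [ContinuousLinearMap.compL_apply] at h
  simp only [coeffApply, h, _root_.sum_apply, map_sum,
    ContinuousLinearMap.comp_apply]
  rw [sum_sigma', sum_sigma']
  refine sum_nbij' (fun q => ⟨(q.2.1, q.2.2 + q.1.2), (q.2.2, q.1.2)⟩)
    (fun q => ⟨(q.1.1 + q.2.1, q.2.2), (q.1.1, q.2.1)⟩) ?_ ?_ ?_ ?_ ?_ <;>
    rintro ⟨⟨a, b⟩, c, d⟩ hq <;>
    simp only [mem_sigma, HasAntidiagonal.mem_antidiagonal] at hq ⊢
  · exact ⟨by omega, trivial⟩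
  · exact ⟨by omega, trivial⟩
  · obtain ⟨rfl, rfl⟩ := hq; rfl
  · obtain ⟨rfl, rfl⟩ := hq; rfl

omit [CompleteSpace X] in
/-- If `A' L = M A` near `k`, then `L` maps the Jordan chains of `A` at `k` to Jordan chains of
`A'` at `k`, as long as the leading vector is not annihilated. -/
lemma IsJordanChain.map {A : ℂ → X →L[ℂ] Y} {A' : ℂ → X' →L[ℂ] Y'} {L : ℂ → X →L[ℂ] X'}
    {M : ℂ → Y →L[ℂ] Y'} {k : ℂ} (hA : AnalyticAt ℂ A k) (hA' : AnalyticAt ℂ A' k)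
    (hL : AnalyticAt ℂ L k) (hM : AnalyticAt ℂ M k)
    (h : ∀ᶠ z in 𝓝 k, (A' z).comp (L z) = (M z).comp (A z)) {n : ℕ} {u : ℕ → X}
    (hu : IsJordanChain A k n u) (h0 : L k (u 0) ≠ 0) :
    IsJordanChain A' k n (coeffApply L k u) := by
  rw [isJordanChain_iff] at hu ⊢
  refine ⟨hu.1, by simpa, fun j hj => ?_⟩
  rw [← coeffApply_comp hA' hL, coeffApply_congr h, coeffApply_comp hM hA]
  exact coeffApply_eq_zero_of_forall_le fun i hi => hu.2.2 i (hi.trans_lt hj)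

/-- Two operator functions that are intertwined in both directions, by maps that restrict at `k`
to mutually inverse bijections of the null spaces, have the same algebraic multiplicities
at `k`. -/
lemma HasAlgebraicMultiplicity.map {A : ℂ → X →L[ℂ] Y} {A' : ℂ → X' →L[ℂ] Y'}
    {L : ℂ → X →L[ℂ] X'} {M : ℂ → Y →L[ℂ] Y'} {L' : ℂ → X' →L[ℂ] X} {M' : ℂ → Y' →L[ℂ] Y} {k : ℂ}
    (hA : AnalyticAt ℂ A k) (hA' : AnalyticAt ℂ A' k)
    (hL : AnalyticAt ℂ L k) (hM : AnalyticAt ℂ M k)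
    (hL' : AnalyticAt ℂ L' k) (hM' : AnalyticAt ℂ M' k)
    (h : ∀ᶠ z in 𝓝 k, (A' z).comp (L z) = (M z).comp (A z))
    (h' : ∀ᶠ z in 𝓝 k, (A z).comp (L' z) = (M' z).comp (A' z))
    (hLL : ∀ x, A k x = 0 → L' k (L k x) = x) (hLL' : ∀ x, A' k x = 0 → L k (L' k x) = x)
    {p : ℕ} (hp : HasAlgebraicMultiplicity A k p) : HasAlgebraicMultiplicity A' k p := by
  obtain ⟨r, u, n, hu, rfl⟩ := hp
  have hinj : Set.InjOn (L k) (LinearMap.ker (A k : X →ₗ[ℂ] Y)) := fun x hx y hy hxy => by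
    rw [← hLL x hx, hxy, hLL y hy]
  have hnz (x : X) (hx : A k x = 0) (h0 : x ≠ 0) : L k x ≠ 0 := fun h1 =>
    h0 (by rw [← hLL x hx, h1, map_zero])
  have hnz' (x : X') (hx : A' k x = 0) (h0 : x ≠ 0) : L' k x ≠ 0 := fun h1 =>
    h0 (by rw [← hLL' x hx, h1, map_zero])
  have hmem (x : X) (hx : A k x = 0) : A' k (L k x) = 0 := by
    simpa [hx] using congr($h.self_of_nhds x)
  have hmem' (x : X') (hx : A' k x = 0) : A k (L' k x) = 0 := by
    simpa [hx] using congr($h'.self_of_nhds x)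
  refine ⟨r, fun i => coeffApply L k (u i), n, ⟨fun i => ?_, ?_, ?_, fun i N ψ hψ hspan => ?_⟩, rfl⟩
  · exact (hu.isJordanChain i).map hA hA' hL hM h
      (hnz _ (hu.isJordanChain i).apply_leading (hu.isJordanChain i).leading_ne_zero)
  · simp only [coeffApply_zero]
    refine hu.linearIndependent.map_injOn (L k : X →ₗ[ℂ] X') ?_
    rw [hu.span_eq]
    exact hinj
  · simp only [coeffApply_zero]
    rw [Set.range_comp' (L k) (fun i => u i 0)]
    change Submodule.span ℂ ((L k : X →ₗ[ℂ] X') '' _) = _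
    rw [Submodule.span_image, hu.span_eq]
    ext x
    constructor
    · rintro ⟨y, hy, rfl⟩
      exact hmem y hy
    · exact fun hx => ⟨L' k x, hmem' x hx, hLL' x hx⟩
  · refine hu.maximal i N _ (hψ.map hA' hA hL' hM' h' (hnz' _ hψ.apply_leading
      hψ.leading_ne_zero)) fun hmem => hspan ?_
    simp only [coeffApply_zero] at hmem ⊢
    have := Submodule.mem_map_of_mem (f := (L k : X →ₗ[ℂ] X')) hmem
    rw [← Submodule.span_image, Set.image_image] at this
    simpa [hLL' _ hψ.apply_leading] using this

end JordanChains

/-! ### Existence of the algebraic multiplicity -/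

section ExistenceOfMultiplicity

lemma linearIndependent_fin_of_notMem_span_image {K V : Type*} [DivisionRing K] [AddCommGroup V]
    [Module K V] (w : ℕ → V) (r : ℕ)
    (h : ∀ i < r, w i ∉ Submodule.span K (w '' Set.Iio i)) :
    LinearIndependent K (fun i : Fin r => w i) := by
  induction r with
  | zero => exact linearIndependent_empty_type
  | succ r ih =>
    have hs : (fun i : Fin (r + 1) => w i) = Fin.snoc (fun i : Fin r => w i) (w r) := by
      ext i
      refine Fin.lastCases ?_ (fun i => ?_) i <;> simp
    rw [hs, linearIndependent_finSnoc]
    refine ⟨ih fun i hi => h i (hi.trans (Nat.lt_succ_self r)), ?_⟩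
    convert h r (Nat.lt_succ_self r) using 4
    ext x
    simp only [Set.mem_range, Set.mem_image, Set.mem_Iio]
    exact ⟨fun ⟨i, hi⟩ => ⟨i, i.2, hi⟩, fun ⟨i, hi, hx⟩ => ⟨⟨i, hi⟩, hx⟩⟩

variable {X Y : Type*} [NormedAddCommGroup X] [NormedSpace ℂ X]
  [NormedAddCommGroup Y] [NormedSpace ℂ Y]

/-- A greedy choice of Jordan chains of maximal length: a first vector outside the span of the
previous ones exists as long as that span is smaller than the null space. -/
lemma exists_greedy_jordanChains {A : ℂ → X →L[ℂ] Y} {k : ℂ} {N : ℕ}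
    [FiniteDimensional ℂ (LinearMap.ker (A k : X →ₗ[ℂ] Y))]
    (hN : ∀ n u, IsJordanChain A k n u → n ≤ N) (r : ℕ)
    (hr : r ≤ Module.finrank ℂ (LinearMap.ker (A k : X →ₗ[ℂ] Y))) :
    ∃ (u : ℕ → ℕ → X) (n : ℕ → ℕ), ∀ i < r, IsJordanChain A k (n i) (u i) ∧
      u i 0 ∉ Submodule.span ℂ ((fun j => u j 0) '' Set.Iio i) ∧
      ∀ M ψ, IsJordanChain A k M ψ →
        ψ 0 ∉ Submodule.span ℂ ((fun j => u j 0) '' Set.Iio i) → M ≤ n i := by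
  classical
  induction r with
  | zero => exact ⟨fun _ _ => 0, fun _ => 0, fun i hi => absurd hi (Nat.not_lt_zero i)⟩
  | succ r ih =>
    obtain ⟨u, n, hun⟩ := ih (Nat.le_of_succ_le hr)
    set S := Submodule.span ℂ ((fun j => u j 0) '' Set.Iio r) with hS
    obtain ⟨x, hx, hxS⟩ : ∃ x, A k x = 0 ∧ x ∉ S := by
      by_contra! hcon
      have hle : LinearMap.ker (A k : X →ₗ[ℂ] Y) ≤ S := hcon
      have hcoe : (fun j => u j 0) '' Set.Iio r = ((range r).image fun j => u j 0 : Finset X) := by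
        simp [Set.Iio, Finset.coe_image]
      have : FiniteDimensional ℂ S := by
        rw [hS, hcoe]
        exact FiniteDimensional.span_finset ℂ _
      have h1 := Submodule.finrank_mono hle
      have h2 := finrank_span_finset_le_card (R := ℂ) ((range r).image fun j => u j 0)
      rw [Set.finrank, ← hcoe, ← hS] at h2
      have h3 := card_image_le (s := range r) (f := fun j => u j 0)
      rw [card_range] at h3
      omega
    -- The constant chain `x` has length `1`, so the maximum below is taken over a nonempty set.
    let P : ℕ → Prop := fun M => ∃ ψ, IsJordanChain A k M ψ ∧ ψ 0 ∉ S
    have hP1 : P 1 := by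
      refine ⟨fun _ => x, isJordanChain_iff.2 ⟨le_rfl, fun h => hxS (h ▸ S.zero_mem), ?_⟩, hxS⟩
      intro j hj
      obtain rfl : j = 0 := by omega
      simpa using hx
    have h1N : 1 ≤ N := hP1.elim fun ψ hψ => hN 1 ψ hψ.1
    obtain ⟨ψ, hψ, hψS⟩ : P (Nat.findGreatest P N) := Nat.findGreatest_spec h1N hP1
    refine ⟨Function.update u r ψ, Function.update n r (Nat.findGreatest P N), fun i hi => ?_⟩
    have himg : (fun j => Function.update u r ψ j 0) '' Set.Iio i =
        (fun j => u j 0) '' Set.Iio i := by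
      refine Set.image_congr fun j hj => ?_
      have hjr : j ≠ r := by
        have : j < i := hj
        omega
      simp [hjr]
    rw [himg]
    rcases eq_or_ne i r with rfl | hir
    · simp only [Function.update_self]
      exact ⟨hψ, hψS, fun M φ hφ hφS => Nat.le_findGreatest (hN M φ hφ) ⟨φ, hφ, hφS⟩⟩
    · simp only [Function.update_of_ne hir]
      exact hun i (by omega)

/-- If the lengths of Jordan chains are bounded, the algebraic multiplicity exists. -/
lemma exists_hasAlgebraicMultiplicity_of_bounded {A : ℂ → X →L[ℂ] Y} {k : ℂ} {N : ℕ}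
    [FiniteDimensional ℂ (LinearMap.ker (A k : X →ₗ[ℂ] Y))]
    (hN : ∀ n u, IsJordanChain A k n u → n ≤ N) : ∃ p, HasAlgebraicMultiplicity A k p := by
  obtain ⟨u, n, hun⟩ := exists_greedy_jordanChains hN _ le_rfl
  have hli := linearIndependent_fin_of_notMem_span_image (fun j => u j 0) _
    fun i hi => (hun i hi).2.1
  refine ⟨_, _, fun i => u i, fun i => n i, ⟨fun i => (hun i i.2).1, hli, ?_, ?_⟩, rfl⟩
  · refine Submodule.eq_of_le_of_finrank_eq (Submodule.span_le.2 ?_) ?_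
    · rintro _ ⟨i, rfl⟩
      exact (hun i i.2).1.apply_leading
    · rw [finrank_span_eq_card hli, Fintype.card_fin]
  · intro i M ψ hψ hS
    refine (hun i i.2).2.2 M ψ hψ ?_
    convert hS using 4
    ext x
    simp only [Set.mem_image, Set.mem_Iio, Set.mem_ofPred_eq]
    exact ⟨fun ⟨j, hj, hx⟩ => ⟨⟨j, hj.trans i.2⟩, hj, hx⟩, fun ⟨j, hj, hx⟩ => ⟨j, hj, hx⟩⟩

/-- If `C A = d • 1` with a scalar function `d` that vanishes at `k` to the finite
order `N`, then no Jordan chain of `A` at `k` is longer than `N`: for a chain `u` of length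
`n > N`, the `N`-th coefficient of `C A u = d u` would be both `0` and a nonzero multiple
of `u 0`. -/
lemma exists_bound_isJordanChain [CompleteSpace X] [CompleteSpace Y] {A : ℂ → X →L[ℂ] Y}
    {C : ℂ → Y →L[ℂ] X} {d : ℂ → ℂ} {k : ℂ} (hA : AnalyticAt ℂ A k) (hC : AnalyticAt ℂ C k)
    (hd : AnalyticAt ℂ d k) (hCA : ∀ z, (C z).comp (A z) = d z • ContinuousLinearMap.id ℂ X)
    (hd0 : ¬ ∀ᶠ z in 𝓝 k, d z = 0) : ∃ N, ∀ n u, IsJordanChain A k n u → n ≤ N := by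
  have hord : analyticOrderAt d k ≠ ⊤ := fun h => hd0 (analyticOrderAt_eq_top.1 h)
  obtain ⟨N, hN⟩ := ENat.ne_top_iff_exists.1 hord
  obtain ⟨hlt, hne⟩ := (analyticOrderAt_eq_nat_iff_iteratedDeriv_eq_zero hd).1 hN.symm
  refine ⟨N, fun n u hu => ?_⟩
  by_contra! hn
  rw [isJordanChain_iff] at hu
  have h1 : coeffApply C k (coeffApply A k u) N = 0 :=
    coeffApply_eq_zero_of_forall_le fun i hi => hu.2.2 i (hi.trans_lt hn)
  rw [← coeffApply_comp hC hA, coeffApply_congr (Eventually.of_forall hCA), coeffApply,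
    Finset.sum_eq_single (N, 0)] at h1
  · simp [taylorCoeff, iteratedDeriv_smul_const hd.contDiffAt, hne, hu.2.1,
      Nat.factorial_ne_zero] at h1
  · rintro ⟨i, j⟩ hij hne'
    rw [HasAntidiagonal.mem_antidiagonal] at hij
    have hi : i < N := by
      rcases Nat.eq_zero_or_pos j with rfl | hj
      · exact absurd (by simp at hij; simp [hij]) hne'
      · simp only at hij; omega
    simp [taylorCoeff, iteratedDeriv_smul_const hd.contDiffAt, hlt i hi]
  · intro h
    simp at h

lemma Matrix.analyticAt_det {ι : Type*} [Fintype ι] [DecidableEq ι] {M : ℂ → Matrix ι ι ℂ} {k : ℂ}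
    (hM : ∀ i j, AnalyticAt ℂ (fun z => M z i j) k) : AnalyticAt ℂ (fun z => (M z).det) k := by
  simp only [Matrix.det_apply']
  exact Finset.analyticAt_fun_sum _ fun σ _ =>
    analyticAt_const.mul (Finset.analyticAt_fun_prod _ fun i _ => hM _ _)

/-- The entries of the matrix of an analytic family of operators on `ℂᵐ` are analytic. -/
lemma analyticAt_toMatrix'_apply {m : ℕ} {F : ℂ → (Fin m → ℂ) →L[ℂ] (Fin m → ℂ)} {k : ℂ}
    (hF : AnalyticAt ℂ F k) (i j : Fin m) :
    AnalyticAt ℂ (fun z => LinearMap.toMatrix' (F z : (Fin m → ℂ) →ₗ[ℂ] (Fin m → ℂ)) i j) k := by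
  simp only [LinearMap.toMatrix'_apply, ContinuousLinearMap.coe_coe]
  exact (((ContinuousLinearMap.proj (R := ℂ) (φ := fun _ : Fin m => ℂ) i).comp
    (ContinuousLinearMap.apply ℂ (Fin m → ℂ) (Pi.single j 1))).analyticAt _).comp hF

lemma analyticAt_det_toMatrix' {m : ℕ} {F : ℂ → (Fin m → ℂ) →L[ℂ] (Fin m → ℂ)} {k : ℂ}
    (hF : AnalyticAt ℂ F k) : AnalyticAt ℂ
      (fun z => (LinearMap.toMatrix' (F z : (Fin m → ℂ) →ₗ[ℂ] (Fin m → ℂ))).det) k :=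
  Matrix.analyticAt_det (analyticAt_toMatrix'_apply hF)

lemma det_toMatrix'_ne_zero_iff_bijective {m : ℕ} (T : (Fin m → ℂ) →L[ℂ] (Fin m → ℂ)) :
    (LinearMap.toMatrix' (T : (Fin m → ℂ) →ₗ[ℂ] (Fin m → ℂ))).det ≠ 0 ↔ Function.Bijective T := by
  rw [LinearMap.det_toMatrix', ← isUnit_iff_ne_zero, ← LinearMap.isUnit_iff_isUnit_det,
    Module.End.isUnit_iff]
  rfl

/-- An analytic matrix function that is invertible arbitrarily close to `k` has an algebraic
multiplicity at `k`; the adjugate supplies the bound on the lengths of Jordan chains. -/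
lemma exists_hasAlgebraicMultiplicity_of_frequently_bijective {m : ℕ}
    {F : ℂ → (Fin m → ℂ) →L[ℂ] (Fin m → ℂ)} {k : ℂ} (hF : AnalyticAt ℂ F k)
    (h : ∃ᶠ z in 𝓝 k, Function.Bijective (F z)) : ∃ p, HasAlgebraicMultiplicity F k p := by
  let M : ℂ → Matrix (Fin m) (Fin m) ℂ := fun z =>
    LinearMap.toMatrix' (F z : (Fin m → ℂ) →ₗ[ℂ] (Fin m → ℂ))
  let C : ℂ → (Fin m → ℂ) →L[ℂ] (Fin m → ℂ) := fun z => ∑ i, ∑ j, (M z).adjugate i j •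
    LinearMap.toContinuousLinearMap (Matrix.toLin' (Matrix.single i j (1 : ℂ)))
  have hC' (z : ℂ) : (C z : (Fin m → ℂ) →ₗ[ℂ] (Fin m → ℂ)) = Matrix.toLin' (M z).adjugate := by
    conv_rhs => rw [Matrix.matrix_eq_sum_single (M z).adjugate]
    have (i j : Fin m) : Matrix.single i j ((M z).adjugate i j) =
        (M z).adjugate i j • Matrix.single i j (1 : ℂ) := by simp [Matrix.smul_single]
    simp only [this, map_sum, map_smul]
    simp [C]
  have hC : AnalyticAt ℂ C k := by
    refine Finset.analyticAt_fun_sum _ fun i _ => Finset.analyticAt_fun_sum _ fun j _ => ?_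
    refine AnalyticAt.fun_smul ?_ analyticAt_const
    simp only [Matrix.adjugate_apply]
    refine Matrix.analyticAt_det fun a b => ?_
    rcases eq_or_ne a j with rfl | haj
    · simpa using analyticAt_const
    · simp only [Matrix.updateRow_ne haj]
      exact analyticAt_toMatrix'_apply hF a b
  have hCF (z : ℂ) : (C z).comp (F z) = (M z).det • ContinuousLinearMap.id ℂ (Fin m → ℂ) := by
    apply ContinuousLinearMap.coe_injective
    change (C z : (Fin m → ℂ) →ₗ[ℂ] (Fin m → ℂ)) ∘ₗ (F z : (Fin m → ℂ) →ₗ[ℂ] (Fin m → ℂ)) = _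
    rw [hC' z]
    conv_lhs => rw [← Matrix.toLin'_toMatrix' (F z : (Fin m → ℂ) →ₗ[ℂ] (Fin m → ℂ))]
    rw [← Matrix.toLin'_mul, Matrix.adjugate_mul]
    simp
  obtain ⟨N, hN⟩ := exists_bound_isJordanChain hF hC (analyticAt_det_toMatrix' hF) hCF fun h0 =>
    (h.and_eventually h0).exists.elim fun z hz =>
      (det_toMatrix'_ne_zero_iff_bijective _).2 hz.1 hz.2
  exact exists_hasAlgebraicMultiplicity_of_bounded hN

end ExistenceOfMultiplicity

/-! ### Bordered operators -/

section BorderedOperators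

variable {X Y E E' : Type*} [NormedAddCommGroup X] [NormedSpace ℂ X]
  [NormedAddCommGroup Y] [NormedSpace ℂ Y] [NormedAddCommGroup E] [NormedSpace ℂ E]
  [NormedAddCommGroup E'] [NormedSpace ℂ E']

/-- The bordered operator with block matrix `[T, R; P, 0]`, that is,
`(x, w) ↦ (T x + R w, P x)`. -/
noncomputable def bordered (R : E' →L[ℂ] Y) (P : X →L[ℂ] E) (T : X →L[ℂ] Y) :
    (X × E') →L[ℂ] (Y × E) :=
  (T.coprod R).prod (P.comp (ContinuousLinearMap.fst ℂ X E'))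

@[simp]
lemma bordered_apply (R : E' →L[ℂ] Y) (P : X →L[ℂ] E) (T : X →L[ℂ] Y) (q : X × E') :
    bordered R P T q = (T q.1 + R q.2, P q.1) := rfl

/-- The upper right block `E → X` of the inverse of the bordered operator. -/
noncomputable def borderedInvUpper (R : E' →L[ℂ] Y) (P : X →L[ℂ] E) (T : X →L[ℂ] Y) : E →L[ℂ] X :=
  ((ContinuousLinearMap.fst ℂ X E').comp (bordered R P T).inverse).comp
    (ContinuousLinearMap.inr ℂ Y E)

/-- The lower left block `Y → E'` of the inverse of the bordered operator. -/
noncomputable def borderedInvLower (R : E' →L[ℂ] Y) (P : X →L[ℂ] E) (T : X →L[ℂ] Y) : Y →L[ℂ] E' :=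
  ((ContinuousLinearMap.snd ℂ X E').comp (bordered R P T).inverse).comp
    (ContinuousLinearMap.inl ℂ Y E)

/-- The effective operator `E → E'` of `T`: the negative of the lower right block of the inverse of
the bordered operator. With this sign, `T ∘ borderedInvUpper = R ∘ effective`. -/
noncomputable def effective (R : E' →L[ℂ] Y) (P : X →L[ℂ] E) (T : X →L[ℂ] Y) : E →L[ℂ] E' :=
  -((ContinuousLinearMap.snd ℂ X E').comp (bordered R P T).inverse).comp
    (ContinuousLinearMap.inr ℂ Y E)

variable {R : E' →L[ℂ] Y} {P : X →L[ℂ] E} {T : X →L[ℂ] Y}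

lemma inverse_bordered_inr (v : E) : (bordered R P T).inverse (0, v) =
    (borderedInvUpper R P T v, -effective R P T v) := by
  simp [borderedInvUpper, effective]

lemma comp_borderedInvUpper (h : (bordered R P T).IsInvertible) :
    T.comp (borderedInvUpper R P T) = R.comp (effective R P T) := by
  ext v
  have := h.self_apply_inverse (0, v)
  rw [inverse_bordered_inr, bordered_apply, Prod.mk.injEq] at this
  simpa [add_neg_eq_zero] using this.1

lemma apply_borderedInvUpper (h : (bordered R P T).IsInvertible) (v : E) :
    P (borderedInvUpper R P T v) = v := by
  have := h.self_apply_inverse (0, v)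
  rw [inverse_bordered_inr, bordered_apply, Prod.mk.injEq] at this
  exact this.2

lemma inverse_bordered_apply_left (h : (bordered R P T).IsInvertible) (x : X) :
    (bordered R P T).inverse (T x, 0) =
      (x - borderedInvUpper R P T (P x), effective R P T (P x)) := by
  have h1 : (T x, (0 : E)) = bordered R P T (x, 0) - (0, P x) := by simp
  rw [h1, map_sub, h.inverse_apply_self, inverse_bordered_inr]
  simp

lemma effective_comp (h : (bordered R P T).IsInvertible) :
    (effective R P T).comp P = (borderedInvLower R P T).comp T := by
  ext x
  simp [borderedInvLower, inverse_bordered_apply_left h]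

/-- On the null space of `T`, the block `borderedInvUpper R P T` is a left inverse of `P`. -/
lemma borderedInvUpper_apply_of_mem_ker (h : (bordered R P T).IsInvertible) {x : X}
    (hx : T x = 0) : borderedInvUpper R P T (P x) = x := by
  have := inverse_bordered_apply_left h x
  rw [hx, Prod.mk_zero_zero, map_zero, eq_comm, Prod.mk_eq_zero] at this
  exact (sub_eq_zero.1 this.1).symm

lemma effective_apply_of_mem_ker (h : (bordered R P T).IsInvertible) {x : X}
    (hx : T x = 0) : effective R P T (P x) = 0 := by
  simpa [hx] using congr($(effective_comp h) x)

lemma apply_borderedInvUpper_of_mem_ker (h : (bordered R P T).IsInvertible) {v : E}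
    (hv : effective R P T v = 0) : T (borderedInvUpper R P T v) = 0 := by
  simpa [hv] using congr($(comp_borderedInvUpper h) v)

/-- The null spaces of an operator and of its effective operator are isomorphic. -/
noncomputable def kerEquivKerEffective (h : (bordered R P T).IsInvertible) :
    LinearMap.ker (T : X →ₗ[ℂ] Y) ≃ₗ[ℂ] LinearMap.ker (effective R P T : E →ₗ[ℂ] E') where
  toFun x := ⟨P x, effective_apply_of_mem_ker h x.2⟩
  invFun v := ⟨borderedInvUpper R P T v, apply_borderedInvUpper_of_mem_ker h v.2⟩
  map_add' x y := Subtype.ext (by simp)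
  map_smul' c x := Subtype.ext (by simp)
  left_inv x := Subtype.ext (borderedInvUpper_apply_of_mem_ker h x.2)
  right_inv v := Subtype.ext (apply_borderedInvUpper h v)

lemma injective_effective_iff (h : (bordered R P T).IsInvertible) :
    Function.Injective (effective R P T) ↔ Function.Injective T := by
  simp only [injective_iff_map_eq_zero]
  refine ⟨fun hF x hx => ?_, fun hT v hv => ?_⟩
  · rw [← borderedInvUpper_apply_of_mem_ker h hx, hF _ (effective_apply_of_mem_ker h hx), map_zero]
  · rw [← apply_borderedInvUpper h v, hT _ (apply_borderedInvUpper_of_mem_ker h hv), map_zero]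

lemma surjective_effective_iff (h : (bordered R P T).IsInvertible) :
    Function.Surjective (effective R P T) ↔ Function.Surjective T := by
  refine ⟨fun hF y => ?_, fun hT w => ?_⟩
  · -- Solve the bordered equation with data `(y, 0)` and correct the solution by `R w = T (S₊ v)`.
    obtain ⟨v, hv⟩ := hF ((bordered R P T).inverse (y, 0)).2
    have h1 := congr_arg Prod.fst (h.self_apply_inverse (y, 0))
    have h2 : T (borderedInvUpper R P T v) = R (effective R P T v) :=
      congr($(comp_borderedInvUpper h) v)
    exact ⟨((bordered R P T).inverse (y, 0)).1 + borderedInvUpper R P T v, by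
      rw [map_add, h2, hv]; exact h1⟩
  · obtain ⟨x, hx⟩ := hT (R w)
    refine ⟨P x, ?_⟩
    have h1 := inverse_bordered_apply_left h x
    have h2 : (T x, (0 : E)) = bordered R P T (0, w) := by simp [hx]
    rw [h2, h.inverse_apply_self] at h1
    exact (congr_arg Prod.snd h1).symm

lemma bijective_effective_iff (h : (bordered R P T).IsInvertible) :
    Function.Bijective (effective R P T) ↔ Function.Bijective T :=
  and_congr (injective_effective_iff h) (surjective_effective_iff h)

section Analyticity

lemma differentiable_bordered : Differentiable ℂ (bordered R P : (X →L[ℂ] Y) → _) := by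
  have h : (bordered R P : (X →L[ℂ] Y) → _) = fun T =>
      (ContinuousLinearMap.inl ℂ Y E).comp (T.comp (ContinuousLinearMap.fst ℂ X E')) +
        bordered R P 0 := by
    ext T q <;> simp
  rw [h]
  fun_prop

variable [CompleteSpace X] [CompleteSpace E']

lemma isOpen_setOf_isInvertible_bordered :
    IsOpen {T : X →L[ℂ] Y | (bordered R P T).IsInvertible} :=
  (ContinuousLinearEquiv.isOpen (𝕜 := ℂ) (E := X × E') (F := Y × E)).preimage
    differentiable_bordered.continuous

lemma differentiableAt_inverse_bordered {T : X →L[ℂ] Y} (h : (bordered R P T).IsInvertible) :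
    DifferentiableAt ℂ (fun T : X →L[ℂ] Y => (bordered R P T).inverse) T :=
  (h.contDiffAt_map_inverse.differentiableAt one_ne_zero).comp T (differentiable_bordered T)

lemma differentiableAt_effective (h : (bordered R P T).IsInvertible) :
    DifferentiableAt ℂ (effective R P) T := by
  have := differentiableAt_inverse_bordered h
  unfold effective
  fun_prop

lemma differentiableAt_borderedInvUpper (h : (bordered R P T).IsInvertible) :
    DifferentiableAt ℂ (borderedInvUpper R P) T := by
  have := differentiableAt_inverse_bordered h
  unfold borderedInvUpper
  fun_prop

lemma differentiableAt_borderedInvLower (h : (bordered R P T).IsInvertible) :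
    DifferentiableAt ℂ (borderedInvLower R P) T := by
  have := differentiableAt_inverse_bordered h
  unfold borderedInvLower
  fun_prop

end Analyticity

end BorderedOperators

section Fredholm

variable {X Y : Type*} [NormedAddCommGroup X] [NormedSpace ℂ X]
  [NormedAddCommGroup Y] [NormedSpace ℂ Y]

/-- A Fredholm operator becomes invertible after bordering by coordinates `P` on its null space and
by a parametrization `R` of a complement of its range. -/
lemma ContinuousLinearMap.IsFredholm.exists_isInvertible_bordered {T : X →L[ℂ] Y}
    (hT : T.IsFredholm) :
    ∃ (n : ℕ) (R : (Fin n → ℂ) →L[ℂ] Y)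
      (P : X →L[ℂ] (Fin (Module.finrank ℂ (LinearMap.ker (T : X →ₗ[ℂ] Y))) → ℂ)),
      (bordered R P T).IsInvertible := by
  obtain ⟨K⟩ := hT.nonempty_fredholmPackage
  have := K.decDom.finite_X₀
  have := K.decCodom.finite_X₀
  rw [show LinearMap.ker (T : X →ₗ[ℂ] Y) = K.decDom.X₀ from K.ker_eq]
  let e : K.decDom.X₀ ≃L[ℂ] (Fin (Module.finrank ℂ K.decDom.X₀) → ℂ) :=
    ContinuousLinearEquiv.ofFinrankEq (by simp)
  let f : (Fin (Module.finrank ℂ K.decCodom.X₀) → ℂ) ≃L[ℂ] K.decCodom.X₀ :=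
    ContinuousLinearEquiv.ofFinrankEq (by simp)
  let p := K.decDom.X₀.projectionOntoL K.decDom.X₁ K.decDom.isTopCompl.symm
  let q := K.decCodom.X₀.projectionOntoL K.decCodom.X₁ K.decCodom.isTopCompl.symm
  have hTx (x : X) : T x = K.equiv (K.decDom.proj x) := congr($K.eq_equiv x)
  have hpx (x : X) : (K.decDom.proj x : X) + p x = x := by
    have := congr($(Submodule.projectionL_add_projectionL_eq_id K.decDom.isTopCompl) x)
    simpa [p] using this
  have hqy (y : Y) : (K.decCodom.proj y : Y) + q y = y := by
    have := congr($(Submodule.projectionL_add_projectionL_eq_id K.decCodom.isTopCompl) y)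
    simpa [q] using this
  -- The inverse is `(y, v) ↦ (T₁⁻¹ y₁ + e⁻¹ v, f⁻¹ y₀)`, where `T₁` is the invertible part of `T`
  -- and `y = y₁ + y₀` splits along the range of `T` and its complement.
  refine ⟨Module.finrank ℂ K.decCodom.X₀,
    K.decCodom.X₀.subtypeL.comp (f : _ →L[ℂ] K.decCodom.X₀), (e : _ →L[ℂ] _).comp p,
    ContinuousLinearMap.IsInvertible.of_inverse
      (g := ((K.decDom.X₁.subtypeL.comp ((K.equiv.symm : _ →L[ℂ] _).comp K.decCodom.proj)).coprod
        (K.decDom.X₀.subtypeL.comp (e.symm : _ →L[ℂ] _))).prod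
        (((f.symm : _ →L[ℂ] _).comp q).comp (ContinuousLinearMap.fst ℂ Y _))) ?_ ?_⟩
  · refine ContinuousLinearMap.ext fun ⟨y, v⟩ => ?_
    simpa [hTx, p] using hqy y
  · refine ContinuousLinearMap.ext fun ⟨x, w⟩ => ?_
    simpa [hTx, q] using hpx x

end Fredholm

/-! ### Invertibility in punctured neighborhoods -/

section PuncturedInvertibility

variable {X Y : Type*} [NormedAddCommGroup X] [NormedSpace ℂ X]
  [NormedAddCommGroup Y] [NormedSpace ℂ Y]

lemma eq_of_bijective_of_fin {n m : ℕ} {T : (Fin m → ℂ) →L[ℂ] (Fin n → ℂ)}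
    (hT : Function.Bijective T) : n = m := by
  simpa using (LinearEquiv.ofBijective (T : (Fin m → ℂ) →ₗ[ℂ] (Fin n → ℂ)) hT).finrank_eq.symm

variable [CompleteSpace X]

/-- Invertibility of the bordered operator is an open condition, so a map `Φ` that is differentiable
wherever it holds turns an analytic operator function into an analytic function. It is applied to
the effective operator and to the blocks of the inverse of the bordered operator. -/
lemma analyticAt_comp_of_isInvertible_bordered {E E' Z : Type*}
    [NormedAddCommGroup E] [NormedSpace ℂ E] [NormedAddCommGroup E'] [NormedSpace ℂ E']
    [CompleteSpace E'] [NormedAddCommGroup Z] [NormedSpace ℂ Z] [CompleteSpace Z]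
    {R : E' →L[ℂ] Y} {P : X →L[ℂ] E} {Φ : (X →L[ℂ] Y) → Z}
    (hΦ : ∀ {T : X →L[ℂ] Y}, (bordered R P T).IsInvertible → DifferentiableAt ℂ Φ T)
    [CompleteSpace Y] {A : ℂ → X →L[ℂ] Y} {k : ℂ} (hA : AnalyticAt ℂ A k)
    (h : (bordered R P (A k)).IsInvertible) :
    AnalyticAt ℂ (fun z => Φ (A z)) k := by
  rw [Complex.analyticAt_iff_eventually_differentiableAt]
  filter_upwards [hA.eventually_analyticAt,
    hA.continuousAt.eventually (isOpen_setOf_isInvertible_bordered.mem_nhds h)] with z hz hzi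
  exact (hΦ hzi).comp z hz.differentiableAt

variable [CompleteSpace Y]

/-- Locally, a holomorphic Fredholm function is either invertible at all points of a punctured
neighborhood or at none: its invertibility is governed by the determinant of the effective matrix
if that matrix is square, and fails otherwise. -/
lemma eventually_bijective_or_eventually_not_bijective {A : ℂ → X →L[ℂ] Y} {k : ℂ}
    (hA : AnalyticAt ℂ A k) (hF : (A k).IsFredholm) :
    (∀ᶠ z in 𝓝[≠] k, Function.Bijective (A z)) ∨
      ∀ᶠ z in 𝓝[≠] k, ¬ Function.Bijective (A z) := by
  obtain ⟨n, R, P, h⟩ := hF.exists_isInvertible_bordered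
  have hinv : ∀ᶠ z in 𝓝[≠] k, (bordered R P (A z)).IsInvertible :=
    (hA.continuousAt.eventually (isOpen_setOf_isInvertible_bordered.mem_nhds h)).filter_mono
      nhdsWithin_le_nhds
  by_cases hn : n = Module.finrank ℂ (LinearMap.ker (A k : X →ₗ[ℂ] Y))
  · subst hn
    have hdet := analyticAt_det_toMatrix'
      (analyticAt_comp_of_isInvertible_bordered differentiableAt_effective hA h)
    rcases hdet.eventually_eq_zero_or_eventually_ne_zero with h0 | h0
    · right
      filter_upwards [hinv, h0.filter_mono nhdsWithin_le_nhds] with z hz hz0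
      rw [← bijective_effective_iff hz, ← det_toMatrix'_ne_zero_iff_bijective]
      exact not_not.2 hz0
    · left
      filter_upwards [hinv, h0] with z hz hz0
      rwa [← bijective_effective_iff hz, ← det_toMatrix'_ne_zero_iff_bijective]
  · right
    filter_upwards [hinv] with z hz hb
    exact hn (eq_of_bijective_of_fin ((bijective_effective_iff hz).2 hb))

lemma isOpen_setOf_eventually_nhdsNE (p : ℂ → Prop) : IsOpen {k | ∀ᶠ z in 𝓝[≠] k, p z} := by
  rw [isOpen_iff_mem_nhds]
  intro k hk
  have h : ∀ᶠ y in 𝓝[≠] k, ∀ᶠ z in 𝓝[≠] y, p z := by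
    filter_upwards [eventually_eventually_nhdsWithin.2 hk, self_mem_nhdsWithin] with y hy hyk
    rw [isOpen_compl_singleton.nhdsWithin_eq hyk] at hy
    exact hy.filter_mono nhdsWithin_le_nhds
  rw [eventually_nhdsWithin_iff] at h
  filter_upwards [h] with y hy
  rcases eq_or_ne y k with rfl | hyk
  · exact hk
  · exact hy hyk

/-- A holomorphic Fredholm function on a connected open set that is invertible at one point is
invertible in a punctured neighborhood of every point. -/
lemma IsHolomorphicFredholmOn.eventually_bijective {A : ℂ → X →L[ℂ] Y} {Λ : Set ℂ}
    (hA : IsHolomorphicFredholmOn A Λ) (hΛ : IsOpen Λ) (hΛc : IsPreconnected Λ) {k : ℂ}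
    (hk : k ∈ Λ) : ∀ᶠ z in 𝓝[≠] k, Function.Bijective (A z) := by
  have han (z : ℂ) (hz : z ∈ Λ) : AnalyticAt ℂ A z := hA.holomorphic.analyticAt (hΛ.mem_nhds hz)
  obtain ⟨k₁, hk₁, hinv⟩ := hA.exists_invertible
  have h₁ : ∀ᶠ z in 𝓝[≠] k₁, Function.Bijective (A z) := by
    have : {T : X →L[ℂ] Y | T.IsInvertible} ∈ 𝓝 (A k₁) :=
      (ContinuousLinearEquiv.isOpen (𝕜 := ℂ) (E := X) (F := Y)).mem_nhds hinv
    filter_upwards [((han k₁ hk₁).continuousAt.eventually this).filter_mono nhdsWithin_le_nhds]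
      with z hz using hz.bijective
  refine hΛc.subset_left_of_subset_union
    (isOpen_setOf_eventually_nhdsNE fun z => Function.Bijective (A z))
    (isOpen_setOf_eventually_nhdsNE fun z => ¬ Function.Bijective (A z)) ?_
    (fun z hz => eventually_bijective_or_eventually_not_bijective (han z hz) (hA.fredholm z hz))
    ⟨k₁, hk₁, h₁⟩ hk
  refine Set.disjoint_left.2 fun z (hz : ∀ᶠ w in 𝓝[≠] z, Function.Bijective (A w))
    (hz' : ∀ᶠ w in 𝓝[≠] z, ¬ Function.Bijective (A w)) => ?_
  obtain ⟨w, hw, hw'⟩ := (hz.and hz').exists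
  exact hw' hw

end PuncturedInvertibility

/-! ### Reduction to the effective matrix function -/

section Reduction

variable {X Y : Type*} [NormedAddCommGroup X] [NormedSpace ℂ X] [CompleteSpace X]
  [NormedAddCommGroup Y] [NormedSpace ℂ Y] [CompleteSpace Y]

/-- An analytic operator function and its effective operator function have the same algebraic
multiplicities at a point where the bordered operator is invertible. -/
lemma hasAlgebraicMultiplicity_effective_iff {E E' : Type*}
    [NormedAddCommGroup E] [NormedSpace ℂ E] [CompleteSpace E]
    [NormedAddCommGroup E'] [NormedSpace ℂ E'] [CompleteSpace E']
    {R : E' →L[ℂ] Y} {P : X →L[ℂ] E} {A : ℂ → X →L[ℂ] Y} {k : ℂ}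
    (hA : AnalyticAt ℂ A k) (h : (bordered R P (A k)).IsInvertible) (p : ℕ) :
    HasAlgebraicMultiplicity A k p ↔
      HasAlgebraicMultiplicity (fun z => effective R P (A z)) k p := by
  have hinv : ∀ᶠ z in 𝓝 k, (bordered R P (A z)).IsInvertible :=
    hA.continuousAt.eventually (isOpen_setOf_isInvertible_bordered.mem_nhds h)
  have hF : AnalyticAt ℂ (fun z => effective R P (A z)) k :=
    analyticAt_comp_of_isInvertible_bordered differentiableAt_effective hA h
  have hU : AnalyticAt ℂ (fun z => borderedInvUpper R P (A z)) k :=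
    analyticAt_comp_of_isInvertible_bordered differentiableAt_borderedInvUpper hA h
  have hL : AnalyticAt ℂ (fun z => borderedInvLower R P (A z)) k :=
    analyticAt_comp_of_isInvertible_bordered differentiableAt_borderedInvLower hA h
  have hPA : ∀ᶠ z in 𝓝 k, (effective R P (A z)).comp P =
      (borderedInvLower R P (A z)).comp (A z) := hinv.mono fun z hz => effective_comp hz
  have hUA : ∀ᶠ z in 𝓝 k, (A z).comp (borderedInvUpper R P (A z)) =
      R.comp (effective R P (A z)) := hinv.mono fun z hz => comp_borderedInvUpper hz
  exact ⟨HasAlgebraicMultiplicity.map (L := fun _ => P) (M' := fun _ => R) hA hF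
      analyticAt_const hL hU analyticAt_const hPA hUA
      (fun x hx => borderedInvUpper_apply_of_mem_ker h hx) (fun v _ => apply_borderedInvUpper h v),
    HasAlgebraicMultiplicity.map (L' := fun _ => P) (M := fun _ => R) hF hA
      hU analyticAt_const analyticAt_const hL hUA hPA
      (fun v _ => apply_borderedInvUpper h v) (fun x hx => borderedInvUpper_apply_of_mem_ker h hx)⟩

end Reduction

theorem theorem1 {X Y : Type*}
    [NormedAddCommGroup X] [NormedSpace ℂ X] [CompleteSpace X]
    [NormedAddCommGroup Y] [NormedSpace ℂ Y] [CompleteSpace Y]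
    (Λ : Set ℂ) (hΛ_open : IsOpen Λ) (hΛ_conn : IsConnected Λ)
    (A : ℂ → X →L[ℂ] Y) (hA : IsHolomorphicFredholmOn A Λ)
    (k₀ : ℂ) (hk₀ : k₀ ∈ Λ) (hk₀_eig : IsEigenvalueOf A k₀)
    (B : X →L[ℂ] Y) (hB : B ≠ 0) :
    ∃ (V Λ₀ : Set ℂ)
      (F : ℂ → ℂ → (Fin (geometricMultiplicity A k₀) → ℂ) →L[ℂ]
        (Fin (geometricMultiplicity A k₀) → ℂ)),
      IsOpen V ∧ 0 ∈ V ∧ IsOpen Λ₀ ∧ k₀ ∈ Λ₀ ∧ Λ₀ ⊆ Λ ∧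
      (∀ ε ∈ V, DifferentiableOn ℂ (fun k => F ε k) Λ₀) ∧
      (∀ k ∈ Λ₀, DifferentiableOn ℂ (fun ε => F ε k) V) ∧
      (∀ ε ∈ V, ∀ k ∈ Λ₀,
        IsEigenvalueOf (fun z => A z + ε • B) k ↔ IsEigenvalueOf (fun z => F ε z) k) ∧
      geometricMultiplicity (fun z => F 0 z) k₀ = geometricMultiplicity A k₀ ∧
      (∃ p : ℕ, HasAlgebraicMultiplicity A k₀ p) ∧
      (∀ p : ℕ, HasAlgebraicMultiplicity A k₀ p ↔
        HasAlgebraicMultiplicity (fun z => F 0 z) k₀ p) := by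
  have hdiff (z : ℂ) (hz : z ∈ Λ) : DifferentiableAt ℂ A z :=
    hA.holomorphic.differentiableAt (hΛ_open.mem_nhds hz)
  have han : AnalyticAt ℂ A k₀ := hA.holomorphic.analyticAt (hΛ_open.mem_nhds hk₀)
  have hbij := hA.eventually_bijective hΛ_open hΛ_conn.isPreconnected hk₀
  obtain ⟨n, R, P, h⟩ := (hA.fredholm k₀ hk₀).exists_isInvertible_bordered
  have hbij' : ∀ᶠ z in 𝓝[≠] k₀, Function.Bijective (effective R P (A z)) := by
    filter_upwards [hbij, (han.continuousAt.eventually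
      (isOpen_setOf_isInvertible_bordered.mem_nhds h)).filter_mono nhdsWithin_le_nhds] with z hz hzi
    exact (bijective_effective_iff hzi).2 hz
  -- The corank `n` equals `m`, since the effective operator is bijective at some nearby point.
  obtain rfl : n = geometricMultiplicity A k₀ :=
    hbij'.exists.elim fun z hz => eq_of_bijective_of_fin hz
  -- A product neighborhood on which the bordered perturbed operator stays invertible.
  have hcont : ContinuousAt (fun q : ℂ × ℂ => A q.2 + q.1 • B) (0, k₀) := by
    have : ContinuousAt (fun q : ℂ × ℂ => A q.2) (0, k₀) :=
      ContinuousAt.comp (f := Prod.snd) (g := A) han.continuousAt continuousAt_snd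
    exact this.add (continuousAt_fst.smul continuousAt_const)
  have hnhds := hcont.preimage_mem_nhds
    (isOpen_setOf_isInvertible_bordered (R := R) (P := P) |>.mem_nhds (by simpa using h))
  obtain ⟨U, hU, W, hW, hUW⟩ := mem_nhds_prod_iff.1 hnhds
  have hinv (ε : ℂ) (hε : ε ∈ interior U) (k : ℂ) (hk : k ∈ interior W ∩ Λ) :
      (bordered R P (A k + ε • B)).IsInvertible :=
    hUW (Set.mk_mem_prod (interior_subset hε) (interior_subset hk.1))
  refine ⟨interior U, interior W ∩ Λ, fun ε k => effective R P (A k + ε • B), isOpen_interior,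
    mem_interior_iff_mem_nhds.2 hU, isOpen_interior.inter hΛ_open,
    ⟨mem_interior_iff_mem_nhds.2 hW, hk₀⟩, Set.inter_subset_right, fun ε hε k hk => ?_,
    fun k hk ε hε => ?_, fun ε hε k hk => ?_, ?_, ?_, fun p => ?_⟩
  · exact ((differentiableAt_effective (hinv ε hε k hk)).comp k
      ((hdiff k hk.2).add_const (ε • B))).differentiableWithinAt
  · have hε' : DifferentiableAt ℂ (fun ε : ℂ => A k + ε • B) ε := by fun_prop
    exact ((differentiableAt_effective (hinv ε hε k hk)).comp ε hε').differentiableWithinAt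
  · exact not_congr (injective_effective_iff (hinv ε hε k hk)).symm
  · simp only [zero_smul, add_zero]
    exact (kerEquivKerEffective h).finrank_eq.symm
  · obtain ⟨p, hp⟩ := exists_hasAlgebraicMultiplicity_of_frequently_bijective
      (analyticAt_comp_of_isInvertible_bordered differentiableAt_effective han h)
      (hbij'.frequently.filter_mono nhdsWithin_le_nhds)
    exact ⟨p, (hasAlgebraicMultiplicity_effective_iff han h p).2 hp⟩
  · simp only [zero_smul, add_zero]
    exact hasAlgebraicMultiplicity_effective_iff han h p
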